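/- Consider the linear time-varying stochastic system $$x_{k+1}=A_kx_k+B_ku_k+w_k,\qquad y_k=C_kx_k+v_k\qquad(k\in\mathbb N),$$ with $x_k,w_k\in\mathbb R^n$, $u_k\in\mathbb R^m$, $y_k,v_k\in\mathbb R^p$, where $(w_k)$ and $(v_k)$ are zero-mean Gaussian white-noise processes, $x_0$ is Gaussian (possibly degenerate), and $x_0,w_0,w_1,\dots,v_0,v_1,\dots$ are mutually independent. The input is an output feedback: each $u_j$ is a measurable function of $y_0,\dots,y_j$. Let $Q_k=\mathbb E[w_kw_k^\top]$, $R_k=\mathbb E[v_kv_k^\top]$, and let $\hat x_k$ be the Kalman one-step predictor of $x_k$ from $y_0,\dots,y_{k-1}$: $$\hat x_0=\mathbb E[x_0],\qquad \hat x_{k+1}=A_k\hat x_k+B_ku_k+K_k(y_k-C_k\hat x_k),\qquad K_k=A_kP_kC_k^\top(C_kP_kC_k^\top+R_k)^{-1},$$ $$P_0=\mathbb E[(x_0-\hat x_0)(x_0-\hat x_0)^\top],\qquad P_{k+1}=A_kP_kA_k^\top+Q_k-A_kP_kC_k^\top(C_kP_kC_k^\top+R_k)^{-1}C_kP_kA_k^\top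 .$$ Fix $k\in\mathbb N$. Suppose that $C_jP_jC_j^\top+R_j$ is invertible for all $j\le k$ and that $u_k$ is a measurable function of $y_0,\dots,y_{k-1}$ (for example, of $\hat x_k$). Let $h:\mathbb R^n\to\mathbb R$ be twice continuously differentiable with $\sup_{x\in\mathbb R^n}\|\nabla^2h(x)\|_2\le\lambda_{\max}$ for some $\lambda_{\max}>0$, and let $\alpha\in\mathbb R$ and $c_J'\ge 0$ be such that, almost surely, $$h(A_k\hat x_k+B_ku_k)-c_J'\ \ge\ \alpha\,h(\hat x_k).$$ If $h(\hat x_{k+1})$ is integrable, then for every $$\delta'\ \le\ c_J'-\frac{\lambda_{\max}}2\operatorname{tr}\!\big(K_k\,\mathrm{cov}[v_k]\,K_k^\top\big)-\frac{\lambda_{\max}}2\operatorname{tr}\!\big(K_kC_kP_kC_k^\top K_k^\top\big)$$ one has, almost surely, $$\mathbb E\big[h(\hat x_{k+1})\mid\hat x_k\big]\ \ge\ \alpha\,h(\hat x_k)+\delta'.$$ Moreover, $h(\hat x_{k+1})$ is integrable whenever $u_0,\dots,u_k$ have finite second moments. -/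

import Mathlib

open MeasureTheory ProbabilityTheory Matrix

noncomputable section

namespace KalmanCBF

variable {Ω : Type*} {n m p : ℕ}

/-- The matrix `M` acting on Euclidean column vectors. -/
def act {a b : ℕ} (M : Matrix (Fin a) (Fin b) ℝ) (z : EuclideanSpace ℝ (Fin b)) :
    EuclideanSpace ℝ (Fin a) :=
  WithLp.toLp 2 (M *ᵥ z.ofLp)

/-- The sigma-algebra generated by the first `k` measurements `y 0, …, y (k - 1)`. -/
abbrev obsSigma (y : ℕ → Ω → EuclideanSpace ℝ (Fin p)) (k : ℕ) : MeasurableSpace Ω :=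
  ⨆ j : Fin k, MeasurableSpace.comap (y j) inferInstance

variable [MeasurableSpace Ω]

/-- The matrix of second moments `E[X Xᵀ]` of a random vector. -/
def secondMoment {a : ℕ} (μ : Measure Ω) (X : Ω → EuclideanSpace ℝ (Fin a)) :
    Matrix (Fin a) (Fin a) ℝ :=
  Matrix.of fun i j => ∫ ω, X ω i * X ω j ∂μ

/-- The covariance matrix `cov[X]` of a random vector. -/
def covMatrix {a : ℕ} (μ : Measure Ω) (X : Ω → EuclideanSpace ℝ (Fin a)) :
    Matrix (Fin a) (Fin a) ℝ :=
  Matrix.of fun i j => ProbabilityTheory.covariance (fun ω => X ω i) (fun ω => X ω j) μ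

/-- Initial state `x₀`, disturbances `w` and measurement noises `v`: `x₀` is Gaussian
(possibly degenerate, e.g. deterministic), `w` and `v` are zero-mean Gaussian white noises, and
`x₀, w 0, w 1, …, v 0, v 1, …` are mutually independent. -/
structure GaussianData (μ : Measure Ω) (x₀ : Ω → EuclideanSpace ℝ (Fin n))
    (w : ℕ → Ω → EuclideanSpace ℝ (Fin n)) (v : ℕ → Ω → EuclideanSpace ℝ (Fin p)) : Prop where
  measurable_init : Measurable x₀
  measurable_w : ∀ k, Measurable (w k)
  measurable_v : ∀ k, Measurable (v k)
  gaussian_init : HasGaussianLaw x₀ μ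
  gaussian_w : ∀ k, HasGaussianLaw (w k) μ
  gaussian_v : ∀ k, HasGaussianLaw (v k) μ
  mean_w : ∀ k, ∫ ω, w k ω ∂μ = 0
  mean_v : ∀ k, ∫ ω, v k ω ∂μ = 0
  white_w : iIndepFun w μ
  white_v : iIndepFun v μ
  indep_w_v : IndepFun (fun ω k => w k ω) (fun ω k => v k ω) μ
  indep_init : IndepFun x₀ (fun ω => ((fun k => w k ω), (fun k => v k ω))) μ

/-- The closed-loop system `x (k+1) = A k x k + B k u k + w k`, `y k = C k x k + v k` under an
output-feedback input: `u k` is a measurable function of `y 0, …, y k`. -/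
structure IsTrajectory (A : ℕ → Matrix (Fin n) (Fin n) ℝ) (B : ℕ → Matrix (Fin n) (Fin m) ℝ)
    (C : ℕ → Matrix (Fin p) (Fin n) ℝ) (w : ℕ → Ω → EuclideanSpace ℝ (Fin n))
    (v : ℕ → Ω → EuclideanSpace ℝ (Fin p)) (x : ℕ → Ω → EuclideanSpace ℝ (Fin n))
    (u : ℕ → Ω → EuclideanSpace ℝ (Fin m)) (y : ℕ → Ω → EuclideanSpace ℝ (Fin p)) : Prop where
  state_eq : ∀ k ω, x (k + 1) ω = act (A k) (x k ω) + act (B k) (u k ω) + w k ω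
  output_eq : ∀ k ω, y k ω = act (C k) (x k ω) + v k ω
  output_feedback : ∀ k, Measurable[obsSigma y (k + 1)] (u k)

/-- The prediction error covariance `P k`, by the Riccati recursion with `Q k = E[w k (w k)ᵀ]`,
`R k = E[v k (v k)ᵀ]` and `P 0 = E[(x₀ - E x₀) (x₀ - E x₀)ᵀ]`. -/
def errCov (μ : Measure Ω) (A : ℕ → Matrix (Fin n) (Fin n) ℝ) (C : ℕ → Matrix (Fin p) (Fin n) ℝ)
    (x₀ : Ω → EuclideanSpace ℝ (Fin n)) (w : ℕ → Ω → EuclideanSpace ℝ (Fin n))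
    (v : ℕ → Ω → EuclideanSpace ℝ (Fin p)) : ℕ → Matrix (Fin n) (Fin n) ℝ
  | 0 => secondMoment μ (fun ω => x₀ ω - ∫ ω', x₀ ω' ∂μ)
  | k + 1 =>
      A k * errCov μ A C x₀ w v k * (A k)ᵀ + secondMoment μ (w k)
        - A k * errCov μ A C x₀ w v k * (C k)ᵀ
          * (C k * errCov μ A C x₀ w v k * (C k)ᵀ + secondMoment μ (v k))⁻¹
          * C k * errCov μ A C x₀ w v k * (A k)ᵀ

/-- The innovation covariance `C k P k (C k)ᵀ + R k`, which the filter inverts. -/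
def innovCov (μ : Measure Ω) (A : ℕ → Matrix (Fin n) (Fin n) ℝ)
    (C : ℕ → Matrix (Fin p) (Fin n) ℝ)
    (x₀ : Ω → EuclideanSpace ℝ (Fin n)) (w : ℕ → Ω → EuclideanSpace ℝ (Fin n))
    (v : ℕ → Ω → EuclideanSpace ℝ (Fin p)) (k : ℕ) : Matrix (Fin p) (Fin p) ℝ :=
  C k * errCov μ A C x₀ w v k * (C k)ᵀ + secondMoment μ (v k)

/-- The Kalman gain `K k = A k P k (C k)ᵀ (C k P k (C k)ᵀ + R k)⁻¹`. -/
def gain (μ : Measure Ω) (A : ℕ → Matrix (Fin n) (Fin n) ℝ) (C : ℕ → Matrix (Fin p) (Fin n) ℝ)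
    (x₀ : Ω → EuclideanSpace ℝ (Fin n)) (w : ℕ → Ω → EuclideanSpace ℝ (Fin n))
    (v : ℕ → Ω → EuclideanSpace ℝ (Fin p)) (k : ℕ) : Matrix (Fin n) (Fin p) ℝ :=
  A k * errCov μ A C x₀ w v k * (C k)ᵀ * (innovCov μ A C x₀ w v k)⁻¹

/-- The Kalman filter (one-step predictor): `x̂ 0 = E[x₀]` and
`x̂ (k+1) = A k x̂ k + B k u k + K k (y k - C k x̂ k)`. -/
def estimate (μ : Measure Ω) (A : ℕ → Matrix (Fin n) (Fin n) ℝ)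
    (B : ℕ → Matrix (Fin n) (Fin m) ℝ) (C : ℕ → Matrix (Fin p) (Fin n) ℝ)
    (x₀ : Ω → EuclideanSpace ℝ (Fin n)) (w : ℕ → Ω → EuclideanSpace ℝ (Fin n))
    (v : ℕ → Ω → EuclideanSpace ℝ (Fin p)) (u : ℕ → Ω → EuclideanSpace ℝ (Fin m))
    (y : ℕ → Ω → EuclideanSpace ℝ (Fin p)) : ℕ → Ω → EuclideanSpace ℝ (Fin n)
  | 0, _ => ∫ ω', x₀ ω' ∂μ
  | k + 1, ω =>
      act (A k) (estimate μ A B C x₀ w v u y k ω) + act (B k) (u k ω)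
        + act (gain μ A C x₀ w v k) (y k ω - act (C k) (estimate μ A B C x₀ w v u y k ω))

/-- The Hessian `∇²h(z)` as a linear operator of Euclidean space: the derivative of the gradient.
Its operator norm is the spectral norm of the Hessian matrix. -/
def hessian (h : EuclideanSpace ℝ (Fin n) → ℝ) (z : EuclideanSpace ℝ (Fin n)) :
    EuclideanSpace ℝ (Fin n) →L[ℝ] EuclideanSpace ℝ (Fin n) :=
  fderiv ℝ (gradient h) z

end KalmanCBF

end

/-! Write `x̂ (k+1) = s + z` with `s = A k x̂ k + B k u k` and `z = K k ν k`, where `ν k = y k - C k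
x̂ k` is the innovation. The Hessian bound gives `h (s + z) ≥ h s + ⟨∇h s, z⟩ - lam/2 ‖z‖²`
(`abs_taylor_remainder_le`). If `s` is a function of the past and `z` is centred and independent of
it, conditioning on the past removes the linear term and turns the quadratic one into `lam/2 · tr (K
S Kᵀ)`, with `S = C P Cᵀ + R` the covariance of `ν k` (`le_condExp_of_quadratic_le`). Conditioning
again on the coarser `x̂ k` gives the claim, and `K S Kᵀ` splits into the two traces of the
statement.

The probabilistic core is the independence of `ν k` from the past. Under nonlinear feedback `x` and
`y` need not be Gaussian, but the input cancels from `e k = x k - x̂ k` (`isErrorProcess`). Errors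
and innovations are therefore linear in the centred initial state and the noises, hence jointly
Gaussian. The Kalman gain makes `e (k+1)` orthogonal to `ν k` (`riccati_step`), and this propagates
to all earlier innovations, so `ν k` is uncorrelated with, hence independent of, the past ones
(`indepFun_innov`). These determine the measurements (`obsSigma_le_obsSigma_innovation`).

Neither `h s` nor `∇h s` need be integrable, so the conditional estimates are localized to sets
where the relevant quantities are bounded. -/

namespace KalmanCBF

/-! ### Second-moment calculus for random vectors -/

section Moments

variable {Ω : Type*} [MeasurableSpace Ω] {μ : Measure Ω} {a b c : ℕ}

/-- The matrix of second cross moments `E[X Yᵀ]` of two random vectors. -/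
noncomputable def crossMoment (μ : Measure Ω) (X : Ω → EuclideanSpace ℝ (Fin a))
    (Y : Ω → EuclideanSpace ℝ (Fin b)) : Matrix (Fin a) (Fin b) ℝ :=
  Matrix.of fun i j => ∫ ω, X ω i * Y ω j ∂μ

/-- `act M` as a continuous linear map. -/
noncomputable def actCLM (M : Matrix (Fin a) (Fin b) ℝ) :
    EuclideanSpace ℝ (Fin b) →L[ℝ] EuclideanSpace ℝ (Fin a) :=
  (Matrix.toEuclideanLin M).toContinuousLinearMap

lemma act_apply (M : Matrix (Fin a) (Fin b) ℝ) (z : EuclideanSpace ℝ (Fin b)) (i : Fin a) :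
    act M z i = ∑ l, M i l * z l := rfl

lemma measurable_act (M : Matrix (Fin a) (Fin b) ℝ) : Measurable (act M) :=
  (actCLM M).continuous.measurable

lemma memLp_act (M : Matrix (Fin a) (Fin b) ℝ) {X : Ω → EuclideanSpace ℝ (Fin b)}
    (hX : MemLp X 2 μ) : MemLp (fun ω => act M (X ω)) 2 μ :=
  (actCLM M).comp_memLp' hX

lemma integral_act (M : Matrix (Fin a) (Fin b) ℝ) {X : Ω → EuclideanSpace ℝ (Fin b)}
    (hX : Integrable X μ) : ∫ ω, act M (X ω) ∂μ = act M (∫ ω, X ω ∂μ) :=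
  (actCLM M).integral_comp_comm hX

lemma act_zero (M : Matrix (Fin a) (Fin b) ℝ) : act M 0 = 0 := (actCLM M).map_zero

lemma memLp_apply {X : Ω → EuclideanSpace ℝ (Fin a)} (hX : MemLp X 2 μ) (i : Fin a) :
    MemLp (fun ω => X ω i) 2 μ :=
  memLp_piLp_iff.1 hX i

lemma integrable_apply_mul {X : Ω → EuclideanSpace ℝ (Fin a)} {Y : Ω → EuclideanSpace ℝ (Fin b)}
    (hX : MemLp X 2 μ) (hY : MemLp Y 2 μ) (i : Fin a) (j : Fin b) :
    Integrable (fun ω => X ω i * Y ω j) μ :=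
  (memLp_apply hX i).integrable_mul (memLp_apply hY j)

lemma integral_apply [IsFiniteMeasure μ] {X : Ω → EuclideanSpace ℝ (Fin a)} (hX : MemLp X 2 μ)
    (i : Fin a) : (∫ ω, X ω ∂μ) i = ∫ ω, X ω i ∂μ :=
  eval_integral_piLp (fun i => (memLp_apply hX i).integrable one_le_two) i

lemma crossMoment_self (X : Ω → EuclideanSpace ℝ (Fin a)) :
    crossMoment μ X X = secondMoment μ X := rfl

lemma crossMoment_transpose (X : Ω → EuclideanSpace ℝ (Fin a))
    (Y : Ω → EuclideanSpace ℝ (Fin b)) : (crossMoment μ X Y)ᵀ = crossMoment μ Y X := by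
  ext i j
  simp [crossMoment, mul_comm]

lemma crossMoment_add_left {X X' : Ω → EuclideanSpace ℝ (Fin a)}
    {Y : Ω → EuclideanSpace ℝ (Fin b)} (hX : MemLp X 2 μ) (hX' : MemLp X' 2 μ)
    (hY : MemLp Y 2 μ) :
    crossMoment μ (fun ω => X ω + X' ω) Y = crossMoment μ X Y + crossMoment μ X' Y := by
  ext i j
  simp only [crossMoment, of_apply, PiLp.add_apply, add_mul, Matrix.add_apply]
  exact integral_add (integrable_apply_mul hX hY i j) (integrable_apply_mul hX' hY i j)

lemma crossMoment_sub_left {X X' : Ω → EuclideanSpace ℝ (Fin a)}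
    {Y : Ω → EuclideanSpace ℝ (Fin b)} (hX : MemLp X 2 μ) (hX' : MemLp X' 2 μ)
    (hY : MemLp Y 2 μ) :
    crossMoment μ (fun ω => X ω - X' ω) Y = crossMoment μ X Y - crossMoment μ X' Y := by
  ext i j
  simp only [crossMoment, of_apply, PiLp.sub_apply, sub_mul, Matrix.sub_apply]
  exact integral_sub (integrable_apply_mul hX hY i j) (integrable_apply_mul hX' hY i j)

lemma crossMoment_act_left (M : Matrix (Fin c) (Fin a) ℝ) {X : Ω → EuclideanSpace ℝ (Fin a)}
    {Y : Ω → EuclideanSpace ℝ (Fin b)} (hX : MemLp X 2 μ) (hY : MemLp Y 2 μ) :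
    crossMoment μ (fun ω => act M (X ω)) Y = M * crossMoment μ X Y := by
  ext i j
  simp only [crossMoment, of_apply, act_apply, Matrix.mul_apply, Finset.sum_mul, mul_assoc]
  rw [integral_finsetSum _ fun l _ => (integrable_apply_mul hX hY l j).const_mul _]
  simp only [integral_const_mul]

lemma crossMoment_add_right {X : Ω → EuclideanSpace ℝ (Fin a)}
    {Y Y' : Ω → EuclideanSpace ℝ (Fin b)} (hX : MemLp X 2 μ) (hY : MemLp Y 2 μ)
    (hY' : MemLp Y' 2 μ) :
    crossMoment μ X (fun ω => Y ω + Y' ω) = crossMoment μ X Y + crossMoment μ X Y' := by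
  rw [← crossMoment_transpose, crossMoment_add_left hY hY' hX, transpose_add,
    crossMoment_transpose, crossMoment_transpose]

lemma crossMoment_sub_right {X : Ω → EuclideanSpace ℝ (Fin a)}
    {Y Y' : Ω → EuclideanSpace ℝ (Fin b)} (hX : MemLp X 2 μ) (hY : MemLp Y 2 μ)
    (hY' : MemLp Y' 2 μ) :
    crossMoment μ X (fun ω => Y ω - Y' ω) = crossMoment μ X Y - crossMoment μ X Y' := by
  rw [← crossMoment_transpose, crossMoment_sub_left hY hY' hX, transpose_sub,
    crossMoment_transpose, crossMoment_transpose]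

lemma crossMoment_act_right (M : Matrix (Fin c) (Fin b) ℝ) {X : Ω → EuclideanSpace ℝ (Fin a)}
    {Y : Ω → EuclideanSpace ℝ (Fin b)} (hX : MemLp X 2 μ) (hY : MemLp Y 2 μ) :
    crossMoment μ X (fun ω => act M (Y ω)) = crossMoment μ X Y * Mᵀ := by
  rw [← crossMoment_transpose, crossMoment_act_left M hY hX, transpose_mul,
    crossMoment_transpose]

lemma crossMoment_eq_zero_of_indepFun [IsFiniteMeasure μ] {X : Ω → EuclideanSpace ℝ (Fin a)}
    {Y : Ω → EuclideanSpace ℝ (Fin b)} (hX : MemLp X 2 μ) (hY : MemLp Y 2 μ)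
    (hXY : IndepFun X Y μ) (hY0 : ∫ ω, Y ω ∂μ = 0) : crossMoment μ X Y = 0 := by
  ext i j
  have hind : IndepFun (fun ω => X ω i) (fun ω => Y ω j) μ :=
    hXY.comp (φ := fun z : EuclideanSpace ℝ (Fin a) => z i)
      (ψ := fun z : EuclideanSpace ℝ (Fin b) => z j) (by fun_prop) (by fun_prop)
  have hzero : ∫ ω, Y ω j ∂μ = 0 := by rw [← integral_apply hY, hY0]; rfl
  have hmul := hind.integral_mul_eq_mul_integral (memLp_apply hX i).aestronglyMeasurable
    (memLp_apply hY j).aestronglyMeasurable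
  simpa [crossMoment, hzero] using hmul

lemma integral_norm_sq_eq_trace {X : Ω → EuclideanSpace ℝ (Fin a)} (hX : MemLp X 2 μ) :
    ∫ ω, ‖X ω‖ ^ 2 ∂μ = (secondMoment μ X).trace := by
  simp only [EuclideanSpace.real_norm_sq_eq, Matrix.trace, Matrix.diag, secondMoment, of_apply]
  rw [integral_finsetSum _ fun i _ => (memLp_apply hX i).integrable_sq]
  simp only [sq]

lemma covMatrix_eq_secondMoment [IsProbabilityMeasure μ] {X : Ω → EuclideanSpace ℝ (Fin a)}
    (hX : MemLp X 2 μ) (hX0 : ∫ ω, X ω ∂μ = 0) : covMatrix μ X = secondMoment μ X := by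
  ext i j
  have hzero : ∫ ω, X ω i ∂μ = 0 := by rw [← integral_apply hX, hX0]; rfl
  simp only [covMatrix, secondMoment, of_apply]
  rw [covariance_eq_sub (memLp_apply hX i) (memLp_apply hX j), hzero, zero_mul, sub_zero]
  rfl

/-- In a jointly Gaussian family, a centred vector is independent of those it is
uncorrelated with. -/
lemma indepFun_of_crossMoment_eq_zero [IsProbabilityMeasure μ] {k : ℕ}
    {X : Ω → EuclideanSpace ℝ (Fin a)} {Y : Fin k → Ω → EuclideanSpace ℝ (Fin b)}
    (hXY : HasGaussianLaw (fun ω => (X ω, fun j => Y j ω)) μ) (hX0 : ∫ ω, X ω ∂μ = 0)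
    (hcross : ∀ j, crossMoment μ X (Y j) = 0) :
    IndepFun X (fun ω j => Y j ω) μ := by
  have hX : MemLp X 2 μ := hXY.fst.memLp_two
  have hY (j) : MemLp (Y j) 2 μ := (HasGaussianLaw.eval (X := Y) hXY.snd j).memLp_two
  -- Flatten to real coordinates, since the Gaussian independence criterion is phrased with scalar
  -- covariances.
  let L : (EuclideanSpace ℝ (Fin a) × (Fin k → EuclideanSpace ℝ (Fin b))) →L[ℝ]
      (Fin a → ℝ) × (Fin k × Fin b → ℝ) :=
    (ContinuousLinearMap.pi fun i =>
        (EuclideanSpace.proj i).comp (ContinuousLinearMap.fst ℝ _ _)).prod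
      (ContinuousLinearMap.pi fun q =>
        (EuclideanSpace.proj q.2).comp
          ((ContinuousLinearMap.proj q.1).comp (ContinuousLinearMap.snd ℝ _ _)))
  have hL : HasGaussianLaw (fun ω => ((fun i => X ω i), fun q : Fin k × Fin b => Y q.1 ω q.2)) μ :=
    hXY.map_fun L
  have hind := HasGaussianLaw.indepFun_of_covariance_eval (X := fun i ω => X ω i)
    (Y := fun (q : Fin k × Fin b) ω => Y q.1 ω q.2) hL fun i q => by
      have hzero : ∫ ω, X ω i ∂μ = 0 := by rw [← integral_apply hX, hX0]; rfl
      rw [covariance_eq_sub (memLp_apply hX i) (memLp_apply (hY q.1) q.2), hzero, zero_mul,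
        sub_zero]
      exact congrFun (congrFun (hcross q.1) i) q.2
  exact hind.comp (φ := WithLp.toLp 2)
    (ψ := fun (z : Fin k × Fin b → ℝ) j => WithLp.toLp 2 fun l => z (j, l))
    (by fun_prop) (by fun_prop)

end Moments

/-! ### Conditional lower bounds without integrability of the bound -/

section ConditionalExpectation

variable {Ω : Type*} {m mΩ : MeasurableSpace Ω} {μ : Measure Ω} [IsFiniteMeasure μ]

/-- A measurable, not necessarily integrable, lower bound is a lower bound for the conditional
expectation. -/
lemma le_condExp_of_le (hm : m ≤ mΩ) {f g : Ω → ℝ} (hf : Integrable f μ)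
    (hg : StronglyMeasurable[m] g) (hle : ∀ᵐ ω ∂μ, g ω ≤ f ω) :
    ∀ᵐ ω ∂μ, g ω ≤ (μ[f|m]) ω := by
  -- Truncate to the `m`-measurable set `|g| ≤ M`, whose indicator commutes with conditioning.
  -- Countably many `M` exhaust `Ω`, so the exceptional sets stay null.
  have key (M : ℕ) : ∀ᵐ ω ∂μ, |g ω| ≤ M → g ω ≤ (μ[f|m]) ω := by
    set T : Set Ω := {ω | |g ω| ≤ M} with hT
    have hTm : MeasurableSet[m] T :=
      hg.norm.measurable measurableSet_Iic
    have hgT : StronglyMeasurable[m] (T.indicator g) := hg.indicator hTm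
    have hgi : Integrable (T.indicator g) μ := by
      refine Integrable.of_bound (hgT.mono hm).aestronglyMeasurable M (ae_of_all _ fun ω => ?_)
      by_cases hω : ω ∈ T
      · rw [Set.indicator_of_mem hω]
        exact hω
      · simp [Set.indicator_of_notMem hω]
    have hmono := condExp_mono (m := m) hgi (hf.indicator (hm _ hTm))
      (hle.mono fun ω hω => Set.indicator_le_indicator hω)
    rw [condExp_of_stronglyMeasurable hm hgT hgi] at hmono
    filter_upwards [hmono, condExp_indicator hf hTm] with ω h1 h2 hω
    rw [h2, Set.indicator_of_mem (show ω ∈ T from hω),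
      Set.indicator_of_mem (show ω ∈ T from hω)] at h1
    exact h1
  filter_upwards [ae_all_iff.2 key] with ω hω
  obtain ⟨M, hM⟩ := exists_nat_ge |g ω|
  exact hω M hM

variable {a : ℕ}

/-- Conditional expectation of a lower bound that is quadratic in a centred vector independent of
the conditioning sigma-algebra. -/
lemma le_condExp_of_quadratic_le (hm : m ≤ mΩ) {f g : Ω → ℝ}
    {G z : Ω → EuclideanSpace ℝ (Fin a)} (lam : ℝ) (hf : Integrable f μ)
    (hg : StronglyMeasurable[m] g) (hG : StronglyMeasurable[m] G) (hz : Measurable z)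
    (hz2 : MemLp z 2 μ) (hz0 : ∫ ω, z ω ∂μ = 0)
    (hind : Indep (MeasurableSpace.comap z inferInstance) m μ)
    (hle : ∀ᵐ ω ∂μ, g ω + inner ℝ (G ω) (z ω) - lam / 2 * ‖z ω‖ ^ 2 ≤ f ω) :
    ∀ᵐ ω ∂μ, g ω - lam / 2 * ∫ ω', ‖z ω'‖ ^ 2 ∂μ ≤ (μ[f|m]) ω := by
  have hzi : Integrable z μ := hz2.integrable one_le_two
  have hsq : Integrable (fun ω => lam / 2 * ‖z ω‖ ^ 2) μ := hz2.norm.integrable_sq.const_mul _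
  have hcz : μ[z|m] =ᵐ[μ] fun _ => 0 := by
    have := condExp_indep_eq hz.comap_le hm
      (Measurable.stronglyMeasurable (comap_measurable z)) hind
    simpa [hz0] using this
  have hcsq : μ[fun ω => lam / 2 * ‖z ω‖ ^ 2|m] =ᵐ[μ]
      fun _ => lam / 2 * ∫ ω', ‖z ω'‖ ^ 2 ∂μ := by
    have hmeas : StronglyMeasurable[MeasurableSpace.comap z inferInstance]
        (fun ω => lam / 2 * ‖z ω‖ ^ 2) := by
      have : Measurable (fun e : EuclideanSpace ℝ (Fin a) => lam / 2 * ‖e‖ ^ 2) := by fun_prop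
      exact Measurable.stronglyMeasurable (this.comp (comap_measurable z))
    have := condExp_indep_eq hz.comap_le hm hmeas hind
    rwa [integral_const_mul] at this
  -- On `‖G‖ ≤ M` the linear term is integrable, and pulling out the truncated `G` leaves its inner
  -- product with `μ[z|m] = 0`.
  have key (M : ℕ) : ∀ᵐ ω ∂μ, ‖G ω‖ ≤ M →
      g ω - lam / 2 * ∫ ω', ‖z ω'‖ ^ 2 ∂μ ≤ (μ[f|m]) ω := by
    set T : Set Ω := {ω | ‖G ω‖ ≤ M} with hT
    have hTm : MeasurableSet[m] T :=
      hG.norm.measurable measurableSet_Iic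
    have hGT : StronglyMeasurable[m] (T.indicator G) := hG.indicator hTm
    have hGbound : ∀ ω, ‖T.indicator G ω‖ ≤ M := fun ω => by
      by_cases hω : ω ∈ T
      · rw [Set.indicator_of_mem hω]
        exact hω
      · simp [Set.indicator_of_notMem hω]
    have hinner : Integrable (fun ω => inner ℝ (T.indicator G ω) (z ω)) μ := by
      refine (hzi.norm.const_mul (M : ℝ)).mono'
        ((hGT.mono hm).aestronglyMeasurable.inner hzi.aestronglyMeasurable)
        (ae_of_all _ fun ω => (norm_inner_le_norm _ _).trans ?_)
      exact mul_le_mul_of_nonneg_right (hGbound ω) (norm_nonneg _)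
    have hcinner : μ[fun ω => inner ℝ (T.indicator G ω) (z ω)|m] =ᵐ[μ] fun _ => 0 := by
      have := condExp_bilin_of_stronglyMeasurable_left (innerSL ℝ) hGT hinner hzi
      filter_upwards [this, hcz] with ω h1 h2
      have h1' : _ = inner ℝ (T.indicator G ω) ((μ[z|m]) ω) := h1
      rw [h2, inner_zero_right] at h1'
      exact h1'
    have hfT := hf.indicator (hm _ hTm)
    have hsqT := hsq.indicator (hm _ hTm)
    -- The linear and quadratic terms are moved to the integrable side, so that only `g`, possibly
    -- not integrable, remains as the lower bound. Off `T` both sides vanish.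
    have hlower := le_condExp_of_le hm ((hfT.sub hinner).add hsqT) (hg.indicator hTm) (by
      filter_upwards [hle] with ω hω
      by_cases hmem : ω ∈ T
      · simp only [Pi.add_apply, Pi.sub_apply, Set.indicator_of_mem hmem]
        linarith
      · simp [Set.indicator_of_notMem hmem])
    filter_upwards [hlower, condExp_add (hfT.sub hinner) hsqT m, condExp_sub hfT hinner m,
      hcinner, hcsq, condExp_indicator hf hTm, condExp_indicator hsq hTm]
      with ω h1 h2 h3 h4 h5 h6 h7 hω
    have hmem : ω ∈ T := hω
    rw [h2, Pi.add_apply, h3, Pi.sub_apply, h4, h6, h7] at h1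
    simp only [Set.indicator_of_mem hmem, h5] at h1
    linarith
  filter_upwards [ae_all_iff.2 key] with ω hω
  obtain ⟨M, hM⟩ := exists_nat_ge ‖G ω‖
  exact hω M hM

end ConditionalExpectation

/-! ### Second-order Taylor bound -/

section Taylor

variable {n : ℕ} {h : EuclideanSpace ℝ (Fin n) → ℝ}

lemma contDiff_one_gradient (hsmooth : ContDiff ℝ 2 h) : ContDiff ℝ 1 (gradient h) :=
  (InnerProductSpace.toDual ℝ (EuclideanSpace ℝ (Fin n))).symm.contDiff.comp
    (hsmooth.fderiv_right (m := 1) (by norm_num))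

/-- Second-order Taylor estimate under a bound on the Hessian. -/
lemma abs_taylor_remainder_le (hsmooth : ContDiff ℝ 2 h) {lam : ℝ}
    (hhess : ∀ z, ‖hessian h z‖ ≤ lam) (s z : EuclideanSpace ℝ (Fin n)) :
    |h (s + z) - h s - inner ℝ (gradient h s) z| ≤ lam / 2 * ‖z‖ ^ 2 := by
  have hgrad := (contDiff_one_gradient hsmooth).differentiable one_ne_zero
  have hlip (x y : EuclideanSpace ℝ (Fin n)) :
      ‖gradient h y - gradient h x‖ ≤ lam * ‖y - x‖ :=
    Convex.norm_image_sub_le_of_norm_fderiv_le (𝕜 := ℝ) (fun x _ => hgrad x)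
      (fun x _ => hhess x) convex_univ (Set.mem_univ x) (Set.mem_univ y)
  have hderiv (t : ℝ) : HasDerivAt
      (fun t : ℝ => h (s + t • z) - h s - t * inner ℝ (gradient h s) z)
      (inner ℝ (gradient h (s + t • z)) z - inner ℝ (gradient h s) z) t := by
    have hline : HasDerivAt (fun t : ℝ => s + t • z) z t := by
      simpa using ((hasDerivAt_id t).smul_const z).const_add s
    have hh := (hsmooth.differentiable two_ne_zero (s + t • z)).hasGradientAt.hasFDerivAt
    have hcomp := hh.comp_hasDerivAt t hline
    have hlin : HasDerivAt (fun t : ℝ => t * inner ℝ (gradient h s) z)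
        (inner ℝ (gradient h s) z) t := by
      simpa using (hasDerivAt_id t).mul_const (inner ℝ (gradient h s) z)
    simpa using! (hcomp.sub_const (h s)).fun_sub hlin
  -- The majorant of the remainder along `s + t • z`: both vanish at `t = 0`, and the Lipschitz
  -- bound on the gradient compares their derivatives on `[0, 1]`.
  have hB (t : ℝ) : HasDerivAt (fun t : ℝ => lam / 2 * ‖z‖ ^ 2 * t ^ 2) (lam * ‖z‖ ^ 2 * t) t := by
    convert! ((hasDerivAt_id t).pow 2).const_mul (lam / 2 * ‖z‖ ^ 2) using 1
    simp
    ring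
  have := image_norm_le_of_norm_deriv_right_le_deriv_boundary (a := 0) (b := 1)
    (fun t _ => (hderiv t).continuousAt.continuousWithinAt)
    (fun t _ => (hderiv t).hasDerivWithinAt) (by simp) hB (fun t ht => by
      rw [← inner_sub_left]
      refine (norm_inner_le_norm _ _).trans ?_
      have h1 := hlip s (s + t • z)
      rw [add_sub_cancel_left, norm_smul, Real.norm_of_nonneg ht.1] at h1
      nlinarith [norm_nonneg z]) (Set.right_mem_Icc.2 zero_le_one)
  simpa using this

end Taylor

/-! ### Prediction errors and innovations: joint Gaussianity, orthogonality, Riccati recursion -/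

section ErrorProcess

variable {Ω : Type*} [MeasurableSpace Ω] {μ : Measure Ω} {n p : ℕ}
  {A : ℕ → Matrix (Fin n) (Fin n) ℝ} {C : ℕ → Matrix (Fin p) (Fin n) ℝ}
  {K : ℕ → Matrix (Fin n) (Fin p) ℝ}
  {x₀ : Ω → EuclideanSpace ℝ (Fin n)} {w : ℕ → Ω → EuclideanSpace ℝ (Fin n)}
  {v : ℕ → Ω → EuclideanSpace ℝ (Fin p)}
  {e : ℕ → Ω → EuclideanSpace ℝ (Fin n)} {ν : ℕ → Ω → EuclideanSpace ℝ (Fin p)}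

/-- The prediction errors `e` and innovations `ν` of an observer with gains `K`. -/
structure IsErrorProcess (μ : Measure Ω) (A : ℕ → Matrix (Fin n) (Fin n) ℝ)
    (C : ℕ → Matrix (Fin p) (Fin n) ℝ) (K : ℕ → Matrix (Fin n) (Fin p) ℝ)
    (x₀ : Ω → EuclideanSpace ℝ (Fin n)) (w : ℕ → Ω → EuclideanSpace ℝ (Fin n))
    (v : ℕ → Ω → EuclideanSpace ℝ (Fin p)) (e : ℕ → Ω → EuclideanSpace ℝ (Fin n))
    (ν : ℕ → Ω → EuclideanSpace ℝ (Fin p)) : Prop where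
  init : e 0 = fun ω => x₀ ω - ∫ ω', x₀ ω' ∂μ
  step : ∀ k, e (k + 1) = fun ω => act (A k) (e k ω) + w k ω - act (K k) (ν k ω)
  innov : ∀ k, ν k = fun ω => act (C k) (e k ω) + v k ω

namespace GaussianData

lemma memLp_w (hd : GaussianData μ x₀ w v) (j : ℕ) : MemLp (w j) 2 μ :=
  (hd.gaussian_w j).memLp_two

lemma memLp_v (hd : GaussianData μ x₀ w v) (j : ℕ) : MemLp (v j) 2 μ :=
  (hd.gaussian_v j).memLp_two

lemma indepFun_w_v (hd : GaussianData μ x₀ w v) (i j : ℕ) : IndepFun (w i) (v j) μ :=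
  hd.indep_w_v.comp (measurable_pi_apply i) (measurable_pi_apply j)

lemma indepFun_init_w (hd : GaussianData μ x₀ w v) (j : ℕ) : IndepFun x₀ (w j) μ :=
  hd.indep_init.comp measurable_id ((measurable_pi_apply j).comp measurable_fst)

lemma indepFun_init_v (hd : GaussianData μ x₀ w v) (j : ℕ) : IndepFun x₀ (v j) μ :=
  hd.indep_init.comp measurable_id ((measurable_pi_apply j).comp measurable_snd)

/-- The initial state and finitely many noises are jointly Gaussian. -/
lemma hasGaussianLaw_joint (hd : GaussianData μ x₀ w v) (N : ℕ) :
    HasGaussianLaw (fun ω => (x₀ ω - ∫ ω', x₀ ω' ∂μ,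
      ((fun i : Fin N => w i ω), (fun i : Fin N => v i ω)))) μ := by
  have hW : HasGaussianLaw (fun ω (i : Fin N) => w i ω) μ :=
    (hd.white_w.precomp Fin.val_injective).hasGaussianLaw fun i => hd.gaussian_w i
  have hV : HasGaussianLaw (fun ω (i : Fin N) => v i ω) μ :=
    (hd.white_v.precomp Fin.val_injective).hasGaussianLaw fun i => hd.gaussian_v i
  have hind : IndepFun (fun ω (i : Fin N) => w i ω) (fun ω (i : Fin N) => v i ω) μ :=
    hd.indep_w_v.comp
      (φ := fun (z : ℕ → EuclideanSpace ℝ (Fin n)) (i : Fin N) => z i)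
      (ψ := fun (z : ℕ → EuclideanSpace ℝ (Fin p)) (i : Fin N) => z i) (by fun_prop) (by fun_prop)
  have hWV := hind.hasGaussianLaw hW hV
  have hX : HasGaussianLaw (fun ω => x₀ ω - ∫ ω', x₀ ω' ∂μ) μ := by
    constructor
    have := hd.gaussian_init.isGaussian_map
    have hmap : μ.map (fun ω => x₀ ω - ∫ ω', x₀ ω' ∂μ)
        = (μ.map x₀).map (fun z => z - ∫ ω', x₀ ω' ∂μ) :=
      (Measure.map_map (g := fun z => z - ∫ ω', x₀ ω' ∂μ) (by fun_prop)
        hd.measurable_init).symm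
    rw [hmap]
    infer_instance
  have hind' : IndepFun (fun ω => x₀ ω - ∫ ω', x₀ ω' ∂μ)
      (fun ω => ((fun i : Fin N => w i ω), (fun i : Fin N => v i ω))) μ :=
    hd.indep_init.comp (φ := fun z => z - ∫ ω', x₀ ω' ∂μ)
      (ψ := fun (q : (ℕ → EuclideanSpace ℝ (Fin n)) × (ℕ → EuclideanSpace ℝ (Fin p))) =>
        ((fun i : Fin N => q.1 i), (fun i : Fin N => q.2 i))) (by fun_prop) (by fun_prop)
  exact hind'.hasGaussianLaw hX hWV

end GaussianData

namespace IsErrorProcess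

lemma measurable (hd : GaussianData μ x₀ w v) (he : IsErrorProcess μ A C K x₀ w v e ν) (k : ℕ) :
    Measurable (e k) ∧ Measurable (ν k) := by
  have hν (k : ℕ) (h : Measurable (e k)) : Measurable (ν k) := by
    rw [he.innov]
    exact ((measurable_act _).comp h).add (hd.measurable_v k)
  induction k with
  | zero =>
    have h0 : Measurable (e 0) := by
      rw [he.init]
      exact hd.measurable_init.sub_const _
    exact ⟨h0, hν 0 h0⟩
  | succ k ih =>
    have h1 : Measurable (e (k + 1)) := by
      rw [he.step]
      exact (((measurable_act _).comp ih.1).add (hd.measurable_w k)).sub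
        ((measurable_act _).comp ih.2)
    exact ⟨h1, hν _ h1⟩

/-- Innovations are linear images of the initial state and the noises. -/
lemma exists_linear (he : IsErrorProcess μ A C K x₀ w v e ν) (N k : ℕ) (hk : k < N) :
    ∃ (L : (EuclideanSpace ℝ (Fin n) ×
          ((Fin N → EuclideanSpace ℝ (Fin n)) × (Fin N → EuclideanSpace ℝ (Fin p)))) →L[ℝ]
          EuclideanSpace ℝ (Fin n))
      (L' : (EuclideanSpace ℝ (Fin n) ×
          ((Fin N → EuclideanSpace ℝ (Fin n)) × (Fin N → EuclideanSpace ℝ (Fin p)))) →L[ℝ]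
          EuclideanSpace ℝ (Fin p)),
      ∀ ω, e k ω = L (x₀ ω - ∫ ω', x₀ ω' ∂μ, ((fun i => w i ω), (fun i => v i ω))) ∧
        ν k ω = L' (x₀ ω - ∫ ω', x₀ ω' ∂μ, ((fun i => w i ω), (fun i => v i ω))) := by
  induction k with
  | zero =>
    let L := ContinuousLinearMap.fst ℝ (EuclideanSpace ℝ (Fin n))
      ((Fin N → EuclideanSpace ℝ (Fin n)) × (Fin N → EuclideanSpace ℝ (Fin p)))
    refine ⟨L, (actCLM (C 0)).comp L + (ContinuousLinearMap.proj ⟨0, hk⟩).comp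
      ((ContinuousLinearMap.snd ℝ _ _).comp (ContinuousLinearMap.snd ℝ _ _)), fun ω => ?_⟩
    rw [he.innov, he.init]
    exact ⟨rfl, rfl⟩
  | succ k ih =>
    obtain ⟨L, L', h⟩ := ih (by omega)
    let M := (actCLM (A k)).comp L + (ContinuousLinearMap.proj ⟨k, by omega⟩).comp
      ((ContinuousLinearMap.fst ℝ _ _).comp (ContinuousLinearMap.snd ℝ _ _))
      - (actCLM (K k)).comp L'
    have hM (ω) : e (k + 1) ω = M (x₀ ω - ∫ ω', x₀ ω' ∂μ, ((fun i => w i ω), (fun i => v i ω))) := by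
      rw [he.step]
      simp only [(h ω).1, (h ω).2]
      rfl
    refine ⟨M, (actCLM (C (k + 1))).comp M + (ContinuousLinearMap.proj ⟨k + 1, hk⟩).comp
      ((ContinuousLinearMap.snd ℝ _ _).comp (ContinuousLinearMap.snd ℝ _ _)), fun ω => ⟨hM ω, ?_⟩⟩
    rw [he.innov]
    simp only [hM ω]
    rfl

lemma hasGaussianLaw_innov (hd : GaussianData μ x₀ w v)
    (he : IsErrorProcess μ A C K x₀ w v e ν) (k : ℕ) :
    HasGaussianLaw (fun ω => (ν k ω, fun j : Fin k => ν j ω)) μ := by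
  -- All innovations up to time `k` are expressed through one common Gaussian vector, which yields
  -- joint and not merely marginal Gaussianity.
  choose L L' hL using fun j : Fin (k + 1) => he.exists_linear (k + 1) j j.2
  have := (hd.hasGaussianLaw_joint (k + 1)).map_fun
    ((L' (Fin.last k)).prod (ContinuousLinearMap.pi fun j : Fin k => L' j.castSucc))
  refine this.congr (ae_of_all _ fun ω => ?_)
  exact Prod.ext (hL (Fin.last k) ω).2.symm (funext fun j => (hL j.castSucc ω).2.symm)

variable [IsProbabilityMeasure μ]

lemma memLp (hd : GaussianData μ x₀ w v) (he : IsErrorProcess μ A C K x₀ w v e ν) (k : ℕ) :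
    MemLp (e k) 2 μ ∧ MemLp (ν k) 2 μ := by
  have hν (k : ℕ) (h : MemLp (e k) 2 μ) : MemLp (ν k) 2 μ := by
    rw [he.innov]
    exact (memLp_act _ h).add (hd.memLp_v k)
  induction k with
  | zero =>
    have h0 : MemLp (e 0) 2 μ := by
      rw [he.init]
      exact hd.gaussian_init.memLp_two.sub (memLp_const _)
    exact ⟨h0, hν 0 h0⟩
  | succ k ih =>
    have h1 : MemLp (e (k + 1)) 2 μ := by
      rw [he.step]
      exact ((memLp_act _ ih.1).add (hd.memLp_w k)).sub (memLp_act _ ih.2)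
    exact ⟨h1, hν _ h1⟩

lemma integral_eq_zero (hd : GaussianData μ x₀ w v) (he : IsErrorProcess μ A C K x₀ w v e ν)
    (k : ℕ) : ∫ ω, e k ω ∂μ = 0 ∧ ∫ ω, ν k ω ∂μ = 0 := by
  have hei (k) : Integrable (e k) μ := (he.memLp hd k).1.integrable one_le_two
  have hνi (k) : Integrable (ν k) μ := (he.memLp hd k).2.integrable one_le_two
  have hact {a b : ℕ} (M : Matrix (Fin a) (Fin b) ℝ) {X : Ω → EuclideanSpace ℝ (Fin b)}
      (hX : Integrable X μ) : Integrable (fun ω => act M (X ω)) μ :=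
    (actCLM M).integrable_comp hX
  have hwi (k) : Integrable (w k) μ := (hd.memLp_w k).integrable one_le_two
  have hvi (k) : Integrable (v k) μ := (hd.memLp_v k).integrable one_le_two
  have hν (k : ℕ) (h : ∫ ω, e k ω ∂μ = 0) : ∫ ω, ν k ω ∂μ = 0 := by
    rw [he.innov, integral_add (hact _ (hei k)) (hvi k), integral_act _ (hei k), h, hd.mean_v,
      act_zero, add_zero]
  induction k with
  | zero =>
    have h0 : ∫ ω, e 0 ω ∂μ = 0 := by
      rw [he.init, integral_sub hd.gaussian_init.integrable (integrable_const _)]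
      simp
    exact ⟨h0, hν 0 h0⟩
  | succ k ih =>
    have h1 : ∫ ω, e (k + 1) ω ∂μ = 0 := by
      have hsum : Integrable (fun ω => act (A k) (e k ω) + w k ω) μ :=
        (hact _ (hei k)).add (hwi k)
      rw [he.step, integral_sub hsum (hact _ (hνi k)),
        integral_add (hact _ (hei k)) (hwi k), integral_act _ (hei k), integral_act _ (hνi k),
        ih.1, ih.2, hd.mean_w, act_zero, act_zero]
      simp
    exact ⟨h1, hν _ h1⟩

lemma crossMoment_innov_left (hd : GaussianData μ x₀ w v)
    (he : IsErrorProcess μ A C K x₀ w v e ν) (k : ℕ) {b : ℕ} {Y : Ω → EuclideanSpace ℝ (Fin b)}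
    (hY : MemLp Y 2 μ) :
    crossMoment μ (ν k) Y = C k * crossMoment μ (e k) Y + crossMoment μ (v k) Y := by
  rw [he.innov, crossMoment_add_left (memLp_act _ (he.memLp hd k).1) (hd.memLp_v k) hY,
    crossMoment_act_left _ (he.memLp hd k).1 hY]

lemma crossMoment_step_left (hd : GaussianData μ x₀ w v)
    (he : IsErrorProcess μ A C K x₀ w v e ν) (k : ℕ) {b : ℕ} {Y : Ω → EuclideanSpace ℝ (Fin b)}
    (hY : MemLp Y 2 μ) :
    crossMoment μ (e (k + 1)) Y
      = A k * crossMoment μ (e k) Y + crossMoment μ (w k) Y - K k * crossMoment μ (ν k) Y := by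
  obtain ⟨h1, h2⟩ := he.memLp hd k
  have hsum : MemLp (fun ω => act (A k) (e k ω) + w k ω) 2 μ :=
    (memLp_act _ h1).add (hd.memLp_w k)
  rw [he.step, crossMoment_sub_left hsum (memLp_act _ h2) hY,
    crossMoment_add_left (memLp_act _ h1) (hd.memLp_w k) hY, crossMoment_act_left _ h1 hY,
    crossMoment_act_left _ h2 hY]

/-- Prediction errors are uncorrelated with present and future noises. -/
lemma crossMoment_noise (hd : GaussianData μ x₀ w v) (he : IsErrorProcess μ A C K x₀ w v e ν)
    (k : ℕ) : ∀ j, k ≤ j → crossMoment μ (e k) (w j) = 0 ∧ crossMoment μ (e k) (v j) = 0 := by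
  induction k with
  | zero =>
    intro j _
    have h0 : MemLp (e 0) 2 μ := (he.memLp hd 0).1
    have hind {b : ℕ} {Y : Ω → EuclideanSpace ℝ (Fin b)} (h : IndepFun x₀ Y μ) :
        IndepFun (e 0) Y μ := by
      rw [he.init]
      exact h.comp (φ := fun z => z - ∫ ω', x₀ ω' ∂μ) (by fun_prop) measurable_id
    exact ⟨crossMoment_eq_zero_of_indepFun h0 (hd.memLp_w j) (hind (hd.indepFun_init_w j))
        (hd.mean_w j),
      crossMoment_eq_zero_of_indepFun h0 (hd.memLp_v j) (hind (hd.indepFun_init_v j))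
        (hd.mean_v j)⟩
  | succ k ih =>
    intro j hj
    obtain ⟨h1, h2⟩ := ih j (by omega)
    have hww : crossMoment μ (w k) (w j) = 0 := crossMoment_eq_zero_of_indepFun (hd.memLp_w k)
      (hd.memLp_w j) (hd.white_w.indepFun (by omega)) (hd.mean_w j)
    have hvv : crossMoment μ (v k) (v j) = 0 := crossMoment_eq_zero_of_indepFun (hd.memLp_v k)
      (hd.memLp_v j) (hd.white_v.indepFun (by omega)) (hd.mean_v j)
    have hwv : crossMoment μ (w k) (v j) = 0 := crossMoment_eq_zero_of_indepFun (hd.memLp_w k)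
      (hd.memLp_v j) (hd.indepFun_w_v k j) (hd.mean_v j)
    have hvw : crossMoment μ (v k) (w j) = 0 := crossMoment_eq_zero_of_indepFun (hd.memLp_v k)
      (hd.memLp_w j) (hd.indepFun_w_v j k).symm (hd.mean_w j)
    rw [he.crossMoment_step_left hd k (hd.memLp_w j), he.crossMoment_step_left hd k (hd.memLp_v j),
      he.crossMoment_innov_left hd k (hd.memLp_w j), he.crossMoment_innov_left hd k (hd.memLp_v j),
      h1, h2, hww, hvv, hwv, hvw]
    simp

/-- The noise `w k` first enters through `e (k + 1)`, so `j = k` is allowed here. -/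
lemma crossMoment_w_innov (hd : GaussianData μ x₀ w v) (he : IsErrorProcess μ A C K x₀ w v e ν)
    {k j : ℕ} (hjk : j ≤ k) : crossMoment μ (w k) (ν j) = 0 := by
  have hvw : crossMoment μ (v j) (w k) = 0 := crossMoment_eq_zero_of_indepFun (hd.memLp_v j)
    (hd.memLp_w k) (hd.indepFun_w_v k j).symm (hd.mean_w k)
  rw [← crossMoment_transpose, he.crossMoment_innov_left hd j (hd.memLp_w k), hvw,
    (he.crossMoment_noise hd j k hjk).1]
  simp

/-- Strict inequality is needed because `v k` is a summand of `ν k`. -/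
lemma crossMoment_v_innov (hd : GaussianData μ x₀ w v) (he : IsErrorProcess μ A C K x₀ w v e ν)
    {k j : ℕ} (hjk : j < k) : crossMoment μ (v k) (ν j) = 0 := by
  have hvv : crossMoment μ (v j) (v k) = 0 := crossMoment_eq_zero_of_indepFun (hd.memLp_v j)
    (hd.memLp_v k) (hd.white_v.indepFun (by omega)) (hd.mean_v k)
  rw [← crossMoment_transpose, he.crossMoment_innov_left hd j (hd.memLp_v k), hvv,
    (he.crossMoment_noise hd j k hjk.le).2]
  simp

lemma crossMoment_error_innov_self (hd : GaussianData μ x₀ w v)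
    (he : IsErrorProcess μ A C K x₀ w v e ν) (k : ℕ) :
    crossMoment μ (e k) (ν k) = secondMoment μ (e k) * (C k)ᵀ := by
  rw [← crossMoment_transpose, he.crossMoment_innov_left hd k (he.memLp hd k).1,
    ← crossMoment_transpose (e k) (v k), (he.crossMoment_noise hd k k le_rfl).2, transpose_add,
    transpose_mul, crossMoment_transpose, crossMoment_self]
  simp

lemma secondMoment_innov (hd : GaussianData μ x₀ w v) (he : IsErrorProcess μ A C K x₀ w v e ν)
    (k : ℕ) :
    secondMoment μ (ν k) = C k * secondMoment μ (e k) * (C k)ᵀ + secondMoment μ (v k) := by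
  have hvν : crossMoment μ (v k) (ν k) = secondMoment μ (v k) := by
    rw [← crossMoment_transpose, he.crossMoment_innov_left hd k (hd.memLp_v k),
      (he.crossMoment_noise hd k k le_rfl).2, Matrix.mul_zero, zero_add, crossMoment_transpose,
      crossMoment_self]
  rw [← crossMoment_self, he.crossMoment_innov_left hd k (he.memLp hd k).2,
    he.crossMoment_error_innov_self hd k, hvν, Matrix.mul_assoc]

/-- Orthogonality is the normal equation `A P Cᵀ - K S = 0`, which the gain solves when `S` is
invertible. The covariance update is proved together with it because it relies on it. -/
lemma riccati_step (hd : GaussianData μ x₀ w v)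
    (he : IsErrorProcess μ A C (gain μ A C x₀ w v) x₀ w v e ν)
    {k : ℕ} (hP : secondMoment μ (e k) = errCov μ A C x₀ w v k)
    (hinv : IsUnit (innovCov μ A C x₀ w v k)) :
    crossMoment μ (e (k + 1)) (ν k) = 0 ∧
      secondMoment μ (e (k + 1)) = errCov μ A C x₀ w v (k + 1) := by
  obtain ⟨hek, hνk⟩ := he.memLp hd k
  have hek1 := (he.memLp hd (k + 1)).1
  have horth : crossMoment μ (e (k + 1)) (ν k) = 0 := by
    rw [he.crossMoment_step_left hd k hνk, he.crossMoment_error_innov_self hd k,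
      he.crossMoment_w_innov hd le_rfl, crossMoment_self, he.secondMoment_innov hd k, hP, gain,
      ← innovCov, Matrix.mul_assoc _ _ (innovCov μ A C x₀ w v k),
      Matrix.nonsing_inv_mul _ ((Matrix.isUnit_iff_isUnit_det _).1 hinv)]
    simp [Matrix.mul_assoc]
  refine ⟨horth, ?_⟩
  have hνe : crossMoment μ (ν k) (e k) = C k * errCov μ A C x₀ w v k := by
    rw [he.crossMoment_innov_left hd k hek, ← crossMoment_transpose (e k) (v k),
      (he.crossMoment_noise hd k k le_rfl).2, crossMoment_self, hP]
    simp
  have hee : crossMoment μ (e (k + 1)) (e k)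
      = A k * errCov μ A C x₀ w v k
        - gain μ A C x₀ w v k * (C k * errCov μ A C x₀ w v k) := by
    rw [he.crossMoment_step_left hd k hek, hνe, crossMoment_self, hP,
      ← crossMoment_transpose (e k) (w k), (he.crossMoment_noise hd k k le_rfl).1]
    simp
  have hew : crossMoment μ (e (k + 1)) (w k) = secondMoment μ (w k) := by
    rw [he.crossMoment_step_left hd k (hd.memLp_w k), (he.crossMoment_noise hd k k le_rfl).1,
      ← crossMoment_transpose (w k) (ν k), he.crossMoment_w_innov hd le_rfl, crossMoment_self]
    simp
  -- Expand only the right factor of `E[e (k+1) e (k+1)ᵀ]`: orthogonality to `ν k` then removes the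
  -- whole gain term on that side.
  have hexp : secondMoment μ (e (k + 1)) = crossMoment μ (e (k + 1))
      (fun ω => act (A k) (e k ω) + w k ω - act (gain μ A C x₀ w v k) (ν k ω)) := by
    rw [← he.step, crossMoment_self]
  have hsum : MemLp (fun ω => act (A k) (e k ω) + w k ω) 2 μ :=
    (memLp_act _ hek).add (hd.memLp_w k)
  rw [hexp, crossMoment_sub_right hek1 hsum (memLp_act _ hνk),
    crossMoment_add_right hek1 (memLp_act _ hek) (hd.memLp_w k), crossMoment_act_right _ hek1 hek,
    crossMoment_act_right _ hek1 hνk, horth, hee, hew, errCov, gain, ← innovCov]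
  simp only [Matrix.sub_mul, Matrix.mul_assoc, Matrix.zero_mul, sub_zero]
  abel

/-- The Riccati recursion computes the covariance of the prediction error. -/
lemma secondMoment_eq_errCov (hd : GaussianData μ x₀ w v)
    (he : IsErrorProcess μ A C (gain μ A C x₀ w v) x₀ w v e ν)
    {k : ℕ} (hinv : ∀ j < k, IsUnit (innovCov μ A C x₀ w v j)) :
    secondMoment μ (e k) = errCov μ A C x₀ w v k := by
  induction k with
  | zero => rw [he.init, errCov]
  | succ k ih =>
    exact (he.riccati_step hd (ih fun j hj => hinv j (by omega)) (hinv k (by omega))).2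

/-- The gain gives orthogonality one step after `j`. Afterwards the linear error recursion preserves
it, because the new noises are uncorrelated with `ν j`. -/
lemma crossMoment_error_innov (hd : GaussianData μ x₀ w v)
    (he : IsErrorProcess μ A C (gain μ A C x₀ w v) x₀ w v e ν)
    {k j : ℕ} (hjk : j < k)
    (hinv : ∀ j < k, IsUnit (innovCov μ A C x₀ w v j)) : crossMoment μ (e k) (ν j) = 0 := by
  induction k, Nat.succ_le_of_lt hjk using Nat.le_induction with
  | base =>
    exact (he.riccati_step hd (he.secondMoment_eq_errCov hd fun i hi => hinv i (by omega))
      (hinv j (by omega))).1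
  | succ k hk ih =>
    have hν := (he.memLp hd j).2
    rw [he.crossMoment_step_left hd k hν, he.crossMoment_innov_left hd k hν,
      ih hk fun i hi => hinv i (by omega), he.crossMoment_w_innov hd (by omega),
      he.crossMoment_v_innov hd hk]
    simp

/-- The innovation is independent of the past innovations. -/
lemma indepFun_innov (hd : GaussianData μ x₀ w v)
    (he : IsErrorProcess μ A C (gain μ A C x₀ w v) x₀ w v e ν)
    {k : ℕ} (hinv : ∀ j < k, IsUnit (innovCov μ A C x₀ w v j)) :
    IndepFun (ν k) (fun ω (j : Fin k) => ν j ω) μ := by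
  refine indepFun_of_crossMoment_eq_zero (he.hasGaussianLaw_innov hd k)
    (he.integral_eq_zero hd k).2 fun j => ?_
  rw [he.crossMoment_innov_left hd k (he.memLp hd j).2, he.crossMoment_error_innov hd j.2 hinv,
    he.crossMoment_v_innov hd j.2]
  simp

lemma secondMoment_innov_eq_innovCov (hd : GaussianData μ x₀ w v)
    (he : IsErrorProcess μ A C (gain μ A C x₀ w v) x₀ w v e ν)
    {k : ℕ}
    (hinv : ∀ j < k, IsUnit (innovCov μ A C x₀ w v j)) :
    secondMoment μ (ν k) = innovCov μ A C x₀ w v k := by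
  rw [he.secondMoment_innov hd k, he.secondMoment_eq_errCov hd hinv, innovCov]

end IsErrorProcess

end ErrorProcess

/-! ### Sigma-algebras of observation histories -/

section Observations

variable {Ω : Type*} {p : ℕ}

lemma obsSigma_mono (y : ℕ → Ω → EuclideanSpace ℝ (Fin p)) {i j : ℕ} (hij : i ≤ j) :
    obsSigma y i ≤ obsSigma y j :=
  iSup_le fun l => le_iSup (fun l : Fin j => MeasurableSpace.comap (y l) inferInstance)
    ⟨l, l.2.trans_le hij⟩

lemma measurable_obsSigma (y : ℕ → Ω → EuclideanSpace ℝ (Fin p)) {j k : ℕ} (hjk : j < k) :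
    Measurable[obsSigma y k] (y j) :=
  measurable_iff_comap_le.2
    (le_iSup (fun l : Fin k => MeasurableSpace.comap (y l) inferInstance) ⟨j, hjk⟩)

lemma obsSigma_le_comap (y : ℕ → Ω → EuclideanSpace ℝ (Fin p)) (k : ℕ) :
    obsSigma y k ≤ MeasurableSpace.comap (fun ω (j : Fin k) => y j ω) inferInstance := by
  refine iSup_le fun j => ?_
  rintro _ ⟨s, hs, rfl⟩
  exact ⟨(fun z => z j) ⁻¹' s, measurable_pi_apply j hs, rfl⟩

end Observations

/-! ### The Kalman filter in closed loop -/

section ClosedLoop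

variable {Ω : Type*} [mΩ : MeasurableSpace Ω] {μ : Measure Ω} {n m p : ℕ}
  {A : ℕ → Matrix (Fin n) (Fin n) ℝ} {B : ℕ → Matrix (Fin n) (Fin m) ℝ}
  {C : ℕ → Matrix (Fin p) (Fin n) ℝ} {w : ℕ → Ω → EuclideanSpace ℝ (Fin n)}
  {v : ℕ → Ω → EuclideanSpace ℝ (Fin p)} {x : ℕ → Ω → EuclideanSpace ℝ (Fin n)}
  {u : ℕ → Ω → EuclideanSpace ℝ (Fin m)} {y : ℕ → Ω → EuclideanSpace ℝ (Fin p)}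

/-- The innovation `y k - C k x̂ k`. -/
noncomputable def innovation (μ : Measure Ω) (A : ℕ → Matrix (Fin n) (Fin n) ℝ)
    (B : ℕ → Matrix (Fin n) (Fin m) ℝ) (C : ℕ → Matrix (Fin p) (Fin n) ℝ)
    (x₀ : Ω → EuclideanSpace ℝ (Fin n)) (w : ℕ → Ω → EuclideanSpace ℝ (Fin n))
    (v : ℕ → Ω → EuclideanSpace ℝ (Fin p)) (u : ℕ → Ω → EuclideanSpace ℝ (Fin m))
    (y : ℕ → Ω → EuclideanSpace ℝ (Fin p)) (k : ℕ) (ω : Ω) : EuclideanSpace ℝ (Fin p) :=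
  y k ω - act (C k) (estimate μ A B C x₀ w v u y k ω)

lemma act_sub {a b : ℕ} (M : Matrix (Fin a) (Fin b) ℝ) (z z' : EuclideanSpace ℝ (Fin b)) :
    act M (z - z') = act M z - act M z' := (actCLM M).map_sub z z'

/-- Plant and filter receive the same `B k u k`, so the input cancels from the error, whatever the
feedback law. -/
lemma isErrorProcess (hsys : IsTrajectory A B C w v x u y) :
    IsErrorProcess μ A C (gain μ A C (x 0) w v) (x 0) w v
      (fun k ω => x k ω - estimate μ A B C (x 0) w v u y k ω)
      (innovation μ A B C (x 0) w v u y) where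
  init := rfl
  step k := by
    funext ω
    simp only [hsys.state_eq, estimate, act_sub, innovation]
    abel
  innov k := by
    funext ω
    simp only [hsys.output_eq, act_sub, innovation]
    abel

/-- The predictor is a function of the past measurements. -/
lemma measurable_estimate (hsys : IsTrajectory A B C w v x u y) (k : ℕ) :
    Measurable[obsSigma y k] (estimate μ A B C (x 0) w v u y k) := by
  induction k with
  | zero => exact measurable_const
  | succ k ih =>
    have hx := ih.mono (obsSigma_mono y k.le_succ) le_rfl
    exact (((measurable_act _).comp hx).add
      ((measurable_act _).comp (hsys.output_feedback k))).add
      ((measurable_act _).comp ((measurable_obsSigma y k.lt_succ_self).sub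
        ((measurable_act _).comp hx)))

/-- The measurements carry no more information than the innovations. -/
lemma obsSigma_le_obsSigma_innovation (hsys : IsTrajectory A B C w v x u y) (k : ℕ) :
    obsSigma y k ≤ obsSigma (innovation μ A B C (x 0) w v u y) k := by
  induction k using Nat.strong_induction_on with
  | _ k ih =>
    refine iSup_le fun j => measurable_iff_comap_le.1 ?_
    -- The predictor at time `j` uses only `y 0, …, y (j - 1)`, so the induction hypothesis at `j <
    -- k` applies, and `y j` is recovered by adding `C j x̂ j` to the innovation.
    have hx := (measurable_estimate (μ := μ) hsys j).mono
      ((ih j j.2).trans (obsSigma_mono _ j.2.le)) le_rfl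
    have hy : y j = fun ω => innovation μ A B C (x 0) w v u y j ω
        + act (C j) (estimate μ A B C (x 0) w v u y j ω) := by
      funext ω
      simp [innovation]
    rw [hy]
    exact (measurable_obsSigma _ j.2).add ((measurable_act _).comp hx)

variable [IsProbabilityMeasure μ]

/-- The innovations are square integrable for any feedback, so only the inputs need a moment
assumption. -/
lemma memLp_estimate (hd : GaussianData μ (x 0) w v) (hsys : IsTrajectory A B C w v x u y)
    {k : ℕ} (hu : ∀ j < k, MemLp (u j) 2 μ) :
    MemLp (estimate μ A B C (x 0) w v u y k) 2 μ := by
  induction k with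
  | zero => exact memLp_const _
  | succ k ih =>
    exact ((memLp_act _ (ih fun j hj => hu j (by omega))).add
      (memLp_act _ (hu k (by omega)))).add
      (memLp_act _ ((isErrorProcess hsys).memLp hd k).2)

/-- Taylor expansion at `0` shows that `h` grows at most quadratically. -/
lemma integrable_comp_of_hessian_le {h : EuclideanSpace ℝ (Fin n) → ℝ}
    (hsmooth : ContDiff ℝ 2 h) {lam : ℝ} (hhess : ∀ z, ‖hessian h z‖ ≤ lam)
    {X : Ω → EuclideanSpace ℝ (Fin n)} (hX : MemLp X 2 μ) :
    Integrable (fun ω => h (X ω)) μ := by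
  have hbound : Integrable
      (fun ω => |h 0| + ‖gradient h 0‖ * ‖X ω‖ + lam / 2 * ‖X ω‖ ^ 2) μ :=
    ((integrable_const _).add ((hX.norm.integrable one_le_two).const_mul _)).add
      (hX.norm.integrable_sq.const_mul _)
  refine hbound.mono' (hsmooth.continuous.comp_aestronglyMeasurable hX.aestronglyMeasurable)
    (ae_of_all _ fun ω => ?_)
  have h1 := abs_taylor_remainder_le hsmooth hhess 0 (X ω)
  have h2 := abs_real_inner_le_norm (gradient h 0) (X ω)
  rw [zero_add] at h1
  rw [Real.norm_eq_abs]
  calc |h (X ω)| = |(h (X ω) - h 0 - inner ℝ (gradient h 0) (X ω)) + h 0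
        + inner ℝ (gradient h 0) (X ω)| := by ring_nf
    _ ≤ _ := abs_add_three _ _ _
    _ ≤ _ := by linarith

/-- Lower bound for the conditional expectation of `h (x̂ (k + 1))` given the predictor. -/
lemma condExp_estimate_ge (hd : GaussianData μ (x 0) w v) (hsys : IsTrajectory A B C w v x u y)
    {k : ℕ} (hinv : ∀ j < k, IsUnit (innovCov μ A C (x 0) w v j))
    (huk : Measurable[obsSigma y k] (u k)) {h g : EuclideanSpace ℝ (Fin n) → ℝ}
    (hsmooth : ContDiff ℝ 2 h) (hg : Continuous g) {lam : ℝ}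
    (hhess : ∀ z, ‖hessian h z‖ ≤ lam)
    (hle : ∀ᵐ ω ∂μ, g (estimate μ A B C (x 0) w v u y k ω)
      ≤ h (act (A k) (estimate μ A B C (x 0) w v u y k ω) + act (B k) (u k ω)))
    (hint : Integrable (fun ω => h (estimate μ A B C (x 0) w v u y (k + 1) ω)) μ) :
    ∀ᵐ ω ∂μ, g (estimate μ A B C (x 0) w v u y k ω)
        - lam / 2 * (gain μ A C (x 0) w v k * innovCov μ A C (x 0) w v k
            * (gain μ A C (x 0) w v k)ᵀ).trace
      ≤ (μ[fun ω' => h (estimate μ A B C (x 0) w v u y (k + 1) ω') |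
          MeasurableSpace.comap (estimate μ A B C (x 0) w v u y k) inferInstance]) ω := by
  have he := isErrorProcess (μ := μ) hsys
  set xh := estimate μ A B C (x 0) w v u y
  set ν := innovation μ A B C (x 0) w v u y
  set K := gain μ A C (x 0) w v k
  obtain ⟨-, hν⟩ := he.measurable hd k
  have hν2 : MemLp (ν k) 2 μ := (he.memLp hd k).2
  have hle_amb : obsSigma ν k ≤ mΩ := iSup_le fun j => (he.measurable hd j).2.comap_le
  have hobs : obsSigma y k ≤ obsSigma ν k := obsSigma_le_obsSigma_innovation hsys k
  have hxh : Measurable[obsSigma y k] (xh k) := measurable_estimate hsys k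
  have hxh_innov : Measurable[obsSigma ν k] (xh k) := hxh.mono hobs le_rfl
  have hs : Measurable[obsSigma ν k] (fun ω => act (A k) (xh k ω) + act (B k) (u k ω)) :=
    ((measurable_act _).comp hxh_innov).add ((measurable_act _).comp (huk.mono hobs le_rfl))
  have hz : Measurable (fun ω => act K (ν k ω)) := (measurable_act K).comp hν
  have hz2 : MemLp (fun ω => act K (ν k ω)) 2 μ := memLp_act K hν2
  have hz0 : ∫ ω, act K (ν k ω) ∂μ = 0 := by
    rw [integral_act K (hν2.integrable one_le_two), (he.integral_eq_zero hd k).2, act_zero]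
  have hind : Indep (MeasurableSpace.comap (fun ω => act K (ν k ω)) inferInstance)
      (obsSigma ν k) μ :=
    indep_of_indep_of_le_right ((IndepFun_iff_Indep _ _ _).1
      ((he.indepFun_innov hd hinv).comp (measurable_act K) measurable_id))
      (obsSigma_le_comap ν k)
  have htrace : ∫ ω, ‖act K (ν k ω)‖ ^ 2 ∂μ
      = (K * innovCov μ A C (x 0) w v k * Kᵀ).trace := by
    rw [integral_norm_sq_eq_trace hz2, ← crossMoment_self, crossMoment_act_right K hz2 hν2,
      crossMoment_act_left K hν2 hν2, crossMoment_self,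
      he.secondMoment_innov_eq_innovCov hd hinv]
  -- Condition first on all past innovations: `s` is measurable for them, though not necessarily for
  -- `x̂ k` alone.
  have hstep := le_condExp_of_quadratic_le hle_amb lam hint
    (hg.measurable.comp hxh_innov).stronglyMeasurable
    ((contDiff_one_gradient hsmooth).continuous.measurable.comp hs).stronglyMeasurable
    hz hz2 hz0 hind (by
      filter_upwards [hle] with ω hω
      have hT := (abs_le.1 (abs_taylor_remainder_le hsmooth hhess
        (act (A k) (xh k ω) + act (B k) (u k ω)) (act K (ν k ω)))).1
      have hsucc : xh (k + 1) ω
          = act (A k) (xh k ω) + act (B k) (u k ω) + act K (ν k ω) := rfl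
      rw [hsucc]
      simp only [Function.comp_apply]
      linarith)
  rw [htrace] at hstep
  have hcomap : MeasurableSpace.comap (xh k) inferInstance ≤ obsSigma ν k :=
    measurable_iff_comap_le.1 hxh_innov
  -- The bound depends on `x̂ k` only, so it survives conditioning on `x̂ k`; the tower property
  -- identifies the result.
  have hfinal := le_condExp_of_le (hcomap.trans hle_amb) integrable_condExp
    (((hg.measurable.comp (comap_measurable (xh k))).sub_const _).stronglyMeasurable) hstep
  filter_upwards [hfinal, condExp_condExp_of_le (μ := μ)
    (f := fun ω => h (xh (k + 1) ω)) hcomap hle_amb] with ω h1 h2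
  rw [h2] at h1
  exact h1

end ClosedLoop

end KalmanCBF

/-! ### The main theorem -/

theorem mainTheorem2 {Ω : Type*} [MeasurableSpace Ω] (μ : Measure Ω) [IsProbabilityMeasure μ]
    {n m p : ℕ}
    (A : ℕ → Matrix (Fin n) (Fin n) ℝ) (B : ℕ → Matrix (Fin n) (Fin m) ℝ)
    (C : ℕ → Matrix (Fin p) (Fin n) ℝ)
    (w : ℕ → Ω → EuclideanSpace ℝ (Fin n)) (v : ℕ → Ω → EuclideanSpace ℝ (Fin p))
    (x : ℕ → Ω → EuclideanSpace ℝ (Fin n)) (u : ℕ → Ω → EuclideanSpace ℝ (Fin m))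
    (y : ℕ → Ω → EuclideanSpace ℝ (Fin p))
    (hdata : KalmanCBF.GaussianData μ (x 0) w v)
    (hsys : KalmanCBF.IsTrajectory A B C w v x u y)
    (k : ℕ)
    -- the inverses in the filter equations exist up to time `k`
    (hinv : ∀ j ≤ k, IsUnit (KalmanCBF.innovCov μ A C (x 0) w v j))
    -- the input at time `k` is determined by the data of the predictor at time `k`
    (huk : Measurable[KalmanCBF.obsSigma y k] (u k))
    (xhat : ℕ → Ω → EuclideanSpace ℝ (Fin n))
    (hxhat : xhat = KalmanCBF.estimate μ A B C (x 0) w v u y)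
    (P : Matrix (Fin n) (Fin n) ℝ) (hP : P = KalmanCBF.errCov μ A C (x 0) w v k)
    (K : Matrix (Fin n) (Fin p) ℝ) (hK : K = KalmanCBF.gain μ A C (x 0) w v k)
    (h : EuclideanSpace ℝ (Fin n) → ℝ) (hsmooth : ContDiff ℝ 2 h)
    (lam : ℝ) (hlam : 0 < lam) (hhess : ∀ z, ‖KalmanCBF.hessian h z‖ ≤ lam)
    (α c : ℝ) (hc : 0 ≤ c)
    (hcbf : ∀ᵐ ω ∂μ, h (KalmanCBF.act (A k) (xhat k ω) + KalmanCBF.act (B k) (u k ω)) - c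
      ≥ α * h (xhat k ω)) :
    ((∀ j ≤ k, MemLp (u j) 2 μ) → Integrable (fun ω => h (xhat (k + 1) ω)) μ) ∧
    (Integrable (fun ω => h (xhat (k + 1) ω)) μ →
      ∀ δ : ℝ,
        δ ≤ c - lam / 2 * (K * KalmanCBF.covMatrix μ (v k) * Kᵀ).trace
              - lam / 2 * (K * C k * P * (C k)ᵀ * Kᵀ).trace →
        ∀ᵐ ω ∂μ,
          (μ[fun ω' => h (xhat (k + 1) ω') |
              MeasurableSpace.comap (xhat k) inferInstance]) ω
            ≥ α * h (xhat k ω) + δ) := by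
  subst hxhat hP hK
  refine ⟨fun hu => ?_, fun hint δ hδ => ?_⟩
  · exact KalmanCBF.integrable_comp_of_hessian_le hsmooth hhess
      (KalmanCBF.memLp_estimate hdata hsys fun j hj => hu j (Nat.lt_succ_iff.1 hj))
  · have hbound := KalmanCBF.condExp_estimate_ge hdata hsys (fun j hj => hinv j hj.le) huk
      (g := fun z => α * h z + c) hsmooth
      ((continuous_const.mul hsmooth.continuous).add continuous_const) hhess
      (hcbf.mono fun ω hω => by linarith) hint
    rw [KalmanCBF.covMatrix_eq_secondMoment (hdata.memLp_v k) (hdata.mean_v k)] at hδ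
    -- Splitting `S = C P Cᵀ + R` separates the estimation-error trace from the measurement-noise
    -- trace.
    rw [KalmanCBF.innovCov, Matrix.mul_add, Matrix.add_mul, Matrix.trace_add] at hbound
    simp only [Matrix.mul_assoc] at hδ hbound
    filter_upwards [hbound] with ω hω
    linarith
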